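/- Let $d\in\mathbb{N}$, $\mathbf{n}=(n_1,\dots,n_d)$ with all $n_k\ge 1$, $[\mathbf{n}]=[n_1]\times\dots\times[n_d]$, and let $\mathbb{S}_{\mathbf{n}}=\mathbb{S}_{n_1}\times\dots\times\mathbb{S}_{n_d}$ act on indices by $\pi(\mathbf{i})=(\pi_1(i_1),\dots,\pi_d(i_d))$ and on arrays $x=(x_{\mathbf{i}})_{\mathbf{i}\in[\mathbf{n}]}$ by $[\pi\cdot x]_{\mathbf{i}}=x_{\pi(\mathbf{i})}$. Let $\mathcal{X},\mathcal{Y}$ be standard Borel spaces, and let $\mathbf{X}$ and $\mathbf{Y}$ be random arrays indexed by $[\mathbf{n}]$ with entries in $\mathcal{X}$ and $\mathcal{Y}$, defined on a common probability space that also carries a uniform random variable on $[0,1]$ independent of $(\mathbf{X},\mathbf{Y})$. *Canonical forms.* Fix any canonicalization routine on $\mathcal{X}^{[\mathbf{n}]}$: a measurable map $x\mapsto C_x$ that picks one representative from each $\mathbb{S}_{\mathbf{n}}$-orbit, together with, for each index $\mathbf{i}$ of $x$, its position $\mathbf{i}'=\mathbf{i}'(x)$ in $C_x$, i.e. for some $\pi\in\mathbb{S}_{\mathbf{n}}$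 one has $C_x=\pi\cdot x$ and $\pi(\mathbf{i}')=\mathbf{i}$. The position is measurable in $x$, and if symmetries of $C_x$ allow several positions, the choice among them does not depend on the presentation of $x$: the position of $\mathbf{i}$ for $\pi\cdot x$ equals the position of $\pi(\mathbf{i})$ for $x$. (Such routines exist on every standard Borel space.) For $s\subseteq[d]$ let $(\mathbf{i}(s),\mathbf{j})$ be the index with $k$-th coordinate $i_k$ if $k\in s$ and $j_k$ if $k\notin s$. The $d$-augmented canonical form of $x$ at $\mathbf{i}$ is the array $C^{(d)}_{\mathbf{i},x}$ with entries $$[C^{(d)}_{\mathbf{i},x}]_{\mathbf{j}}=\Big([C_x]_{\mathbf{j}},\big([C_x]_{(\mathbf{i}'(s),\mathbf{j})}\big)_{s\subseteq[d]}\Big),\qquad \mathbf{j}\in[\mathbf{n}],$$ which records all sub-arrays of $x$ through index $\mathbf{i}$, as they appear in $C_x$. *Theorem.* Suppose that $\mathbf{X}$ is separately exchangeable, i.e. $\pi\cdot\mathbf{X}\overset{d}{=}\mathbf{X}$ for all $\pi\in\mathbb{S}_{\mathbf{n}}$, and that for each $\mathbf{i}\in[\mathbf{n}]$ the entry $Y_{\mathbf{i}}$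 is conditionally independent of the remaining entries $(Y_{\mathbf{j}})_{\mathbf{j}\ne\mathbf{i}}$ given $\mathbf{X}$. Then $P_{\mathbf{Y}|\mathbf{X}}$ is $\mathbb{S}_{\mathbf{n}}$-equivariant, i.e. $P(\mathbf{Y}\in A\mid\mathbf{X}\in B)=P(\pi\cdot\mathbf{Y}\in A\mid\pi\cdot\mathbf{X}\in B)$ for all $\pi\in\mathbb{S}_{\mathbf{n}}$ and all measurable $A,B$ for which the conditioning events have positive probability, if and only if there are a measurable function $f$ with values in $\mathcal{Y}$ and i.i.d. random variables $(\eta_{\mathbf{i}})_{\mathbf{i}\in[\mathbf{n}]}$, uniform on $[0,1]$ and jointly independent of $\mathbf{X}$, such that almost surely $$Y_{\mathbf{i}}=f\big(\eta_{\mathbf{i}},X_{\mathbf{i}},C^{(d)}_{\mathbf{i},\mathbf{X}}\big)\qquad\text{for all }\mathbf{i}\in[\mathbf{n}].$$ -/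

import Mathlib

open MeasureTheory ProbabilityTheory

namespace ExchArray

variable {d : ℕ}

/-- The index set `[n₁] × ⋯ × [n_d]`. -/
abbrev Idx (n : Fin d → ℕ) : Type := ∀ k : Fin d, Fin (n k)

/-- `d`-arrays of size `n` with entries in `α`. -/
abbrev Arr (n : Fin d → ℕ) (α : Type*) : Type _ := Idx n → α

/-- The direct product of the symmetric groups on `[n₁], …, [n_d]`. -/
abbrev PermGroup (n : Fin d → ℕ) : Type := ∀ k : Fin d, Equiv.Perm (Fin (n k))

/-- `(i₁, …, i_d) ↦ (π₁(i₁), …, π_d(i_d))`. -/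
def permIdx {n : Fin d → ℕ} (π : PermGroup n) (i : Idx n) : Idx n := fun k => π k (i k)

/-- The action on arrays: `[π · x]_{i₁,…,i_d} = x_{π₁(i₁),…,π_d(i_d)}`. -/
def act {n : Fin d → ℕ} {α : Type*} (π : PermGroup n) (x : Arr n α) : Arr n α :=
  fun i => x (permIdx π i)

/-- The index `(i(s), j)`: coordinate `k` is `i_k` if `k ∈ s` and `j_k` if `k ∉ s`. -/
def mixIdx {n : Fin d → ℕ} (i : Idx n) (s : Finset (Fin d)) (j : Idx n) : Idx n :=
  fun k => if k ∈ s then i k else j k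

/-- A canonicalization routine for `d`-arrays. `canon x` is the canonical form of `x`, a measurable
choice of one representative from every orbit. `pos x i` is the place in `canon x` of the entry
that `x` has at index `i`: some permutation that carries `x` to `canon x` carries index `i` of `x` to
index `pos x i` of `canon x`. If `canon x` has symmetries there are several such places; the routine
selects one of them in a way that does not depend on the order in which `x` is presented. -/
structure Canonicalization (n : Fin d → ℕ) (α : Type*) [MeasurableSpace α] where
  canon : Arr n α → Arr n α
  pos : Arr n α → Idx n → Idx n
  measurable_canon : Measurable canon
  measurable_pos : ∀ i, Measurable fun x => pos x i
  canon_act : ∀ (π : PermGroup n) (x : Arr n α), canon (act π x) = canon x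
  pos_act : ∀ (π : PermGroup n) (x : Arr n α) (i : Idx n), pos (act π x) i = pos x (permIdx π i)
  exists_perm : ∀ (x : Arr n α) (i : Idx n),
    ∃ π : PermGroup n, canon x = act π x ∧ permIdx π (pos x i) = i

/-- Arrays whose entry at `j` is a pair of an element of `α` and a family of elements of `α` indexed
by the subsets of `[d]` with at most `p` elements. -/
abbrev AugArr (n : Fin d → ℕ) (p : ℕ) (α : Type*) : Type _ :=
  Arr n (α × ({s : Finset (Fin d) // s.card ≤ p} → α))

/-- The `p`-augmented canonical form of `x` at index `i`. With `C` the canonical form of `x` and `i'`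
the place of index `i` in it, the entry at `j` is `(C_j, (C_{(i'(s), j)})_s)`: the sub-arrays of `x`
through index `i`, as they appear in the canonical form, broadcast over `j`. -/
def Canonicalization.aug {n : Fin d → ℕ} {α : Type*} [MeasurableSpace α]
    (c : Canonicalization n α) (p : ℕ) (x : Arr n α) (i : Idx n) : AugArr n p α :=
  fun j => (c.canon x j, fun s => c.canon x (mixIdx (c.pos x i) s.1 j))

variable {Ω : Type*} [MeasurableSpace Ω]

/-- The distribution of `X` is invariant under separate permutations of the `d` index sets. -/
def SeparatelyExchangeable {n : Fin d → ℕ} {α : Type*} [MeasurableSpace α]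
    (P : Measure Ω) (X : Ω → Arr n α) : Prop :=
  ∀ π : PermGroup n, P.map (fun ω => act π (X ω)) = P.map X

/-- `P_{Y|X}` is equivariant: `P(Y ∈ A | X ∈ B) = P(π·Y ∈ A | π·X ∈ B)` for all `π`, `A` and `B`
(where `P(X ∈ B)` and `P(π·X ∈ B)` are positive, so that both conditional probabilities exist). -/
def CondEquivariant {n : Fin d → ℕ} {α β : Type*} [MeasurableSpace α] [MeasurableSpace β]
    (P : Measure Ω) (X : Ω → Arr n α) (Y : Ω → Arr n β) : Prop :=
  ∀ (π : PermGroup n) (A : Set (Arr n β)) (B : Set (Arr n α)),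
    MeasurableSet A → MeasurableSet B →
    P {ω | X ω ∈ B} ≠ 0 → P {ω | act π (X ω) ∈ B} ≠ 0 →
      P[{ω | Y ω ∈ A} | {ω | X ω ∈ B}] =
        P[{ω | act π (Y ω) ∈ A} | {ω | act π (X ω) ∈ B}]

/-- `U` and `V` are conditionally independent given `X`; `P⟦S | m⟧` is the conditional probability of
the event `S` given the σ-algebra `m`, here the one generated by `X`. (Mathlib's `CondIndepFun` is
only available on a standard Borel sample space.) -/
def CondIndepGiven {α β γ : Type*} [mα : MeasurableSpace α] [MeasurableSpace β]
    [MeasurableSpace γ] (P : Measure Ω) (X : Ω → α) (U : Ω → β) (V : Ω → γ) : Prop :=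
  ∀ (A : Set β) (B : Set γ), MeasurableSet A → MeasurableSet B →
    P⟦U ⁻¹' A ∩ V ⁻¹' B | mα.comap X⟧ =ᵐ[P]
      P⟦U ⁻¹' A | mα.comap X⟧ * P⟦V ⁻¹' B | mα.comap X⟧

/-- Every entry of `Y` is conditionally independent of the family of all other entries given `X`. -/
def EntriesCondIndep {n : Fin d → ℕ} {α β : Type*} [MeasurableSpace α] [MeasurableSpace β]
    (P : Measure Ω) (X : Ω → Arr n α) (Y : Ω → Arr n β) : Prop :=
  ∀ i : Idx n, CondIndepGiven P X (fun ω => Y ω i) (fun ω (j : {j : Idx n // j ≠ i}) => Y ω j.1)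

/-- Canonicalization routines exist on every standard Borel space. -/
theorem exists_canonicalization (n : Fin d → ℕ) (α : Type*) [MeasurableSpace α]
    [StandardBorelSpace α] : Nonempty (Canonicalization n α) := by
  classical
  have act_act : ∀ (σ π : PermGroup n) (x : Arr n α), act σ (act π x) = act (π * σ) x :=
    fun _ _ _ => rfl
  have hact : ∀ π : PermGroup n, Measurable (act π : Arr n α → Arr n α) := fun π =>
    measurable_pi_lambda _ fun i => measurable_pi_apply _
  obtain ⟨e, he⟩ := MeasureTheory.exists_measurableEmbedding_real (Arr n α)
  have hmax : ∀ x : Arr n α, ∃ π : PermGroup n, ∀ σ, e (act σ x) ≤ e (act π x) := fun x =>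
    Finite.exists_max fun π => e (act π x)
  choose m hm using hmax
  let canon : Arr n α → Arr n α := fun x => act (m x) x
  have hcact : ∀ π x, canon (act π x) = canon x := by
    intro π x
    apply he.injective
    apply le_antisymm
    · have := hm x (π * m (act π x))
      simpa [canon, act_act] using this
    · have := hm (act π x) (π⁻¹ * m x)
      simpa [canon, act_act] using this
  have hcm : Measurable canon := by
    rw [← he.measurable_comp_iff]
    have : e ∘ canon = fun x => Finset.univ.sup' Finset.univ_nonempty
        (fun π : PermGroup n => e (act π x)) := by
      funext x
      apply le_antisymm
      · exact Finset.le_sup' (fun π : PermGroup n => e (act π x)) (Finset.mem_univ (m x))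
      · exact (Finset.sup'_le_iff _ _).2 fun σ _ => hm x σ
    rw [this]
    have h2 := Finset.measurable_sup' (s := (Finset.univ : Finset (PermGroup n)))
      Finset.univ_nonempty (f := fun π (x : Arr n α) => e (act π x))
      fun π _ => he.measurable.comp (hact π)
    convert h2 using 1
    funext x
    rw [Finset.sup'_apply]
  let S : Arr n α → Idx n → Set (Idx n) := fun x i =>
    {p | ∃ π : PermGroup n, canon x = act π x ∧ permIdx π p = i}
  have hS : ∀ x i, (S x i).Nonempty := fun x i =>
    ⟨permIdx (m x)⁻¹ i, m x, rfl, by funext k; simp [permIdx]⟩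
  have hSact : ∀ π x i, S (act π x) i = S x (permIdx π i) := by
    intro π x i
    ext p
    constructor
    · rintro ⟨σ, h1, h2⟩
      refine ⟨π * σ, ?_, ?_⟩
      · rw [← act_act, ← h1, hcact]
      · rw [← h2]; rfl
    · rintro ⟨σ, h1, h2⟩
      refine ⟨π⁻¹ * σ, ?_, ?_⟩
      · rw [hcact, act_act, mul_inv_cancel_left, h1]
      · funext k
        have := congrFun h2 k
        simp only [permIdx] at this
        simp [permIdx, this]
  let g : Idx n → Set (Idx n) → Idx n := fun i T => if h : T.Nonempty then h.some else i
  have hgS : ∀ x i i', g i (S x i') = (hS x i').some := fun x i i' => dif_pos (hS x i')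
  refine ⟨⟨canon, fun x i => g i (S x i), hcm, fun i => ?_, hcact, fun π x i => ?_, fun x i => ?_⟩⟩
  · have hSm : Measurable fun x => S x i := by
      rw [measurable_set_iff]
      intro p
      apply Measurable.exists
      intro π
      exact Measurable.and (measurableSet_setOfPred.1 (measurableSet_eq_fun hcm (hact π)))
        measurable_const
    exact (measurable_of_finite (g i)).comp hSm
  · simp only [hSact]
    rw [hgS, hgS]
  · rw [hgS]
    exact (hS x i).some_mem

end ExchArray

open ExchArray

/-! For exchangeable X, equivariance of the conditional law amounts to invariance of the law of (X,
Y) under simultaneous permutations. A representation by noise gives this invariance: permuting X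
permutes its augmented forms, and i.i.d. noise keeps its law.

Conversely, invariance yields L(Y_{π(i)} | X = x) = L(Y_i | X = π·x) for almost all x. If C_x = π·x
and π(q) = i, the law of Y_i given x is therefore that of Y_q given C_x. The augmented form records
C_x but not q. It does record the slices through q, and any index with the same slices is as good:
exchanging the coordinates of two such indices is a symmetry of C_x (`act_swap_eq_self`,
`exists_perm_of_mem_places`). Hence one function of the augmented form gives the conditional law of
every entry. Conditional independence makes the joint conditional law a product, so independent
noises reproduce the law of (X, Y). Drawing the noise from its conditional law given (X, Y) turns
this into an almost sure identity (`exists_noise_representation`). -/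

namespace ExchArray

/-! ### Realizing couplings by independent uniform noise -/

section Transfer

variable {Ω γ E : Type*} [MeasurableSpace Ω] [MeasurableSpace γ] [MeasurableSpace E]

/-- A coupling of the law of `W` can be realized on every sample space that carries a uniform
variable independent of `W`. -/
theorem exists_map_prodMk_eq_of_uniform [StandardBorelSpace E] [Nonempty E] {P : Measure Ω}
    [IsProbabilityMeasure P] {W : Ω → γ} (hW : Measurable W) {U : Ω → unitInterval}
    (hU : Measurable U) (hUlaw : P.map U = volume) (hind : IndepFun U W P)
    (ν : Measure (γ × E)) [IsFiniteMeasure ν] (hν : ν.fst = P.map W) :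
    ∃ η : Ω → E, Measurable η ∧ P.map (fun ω => (W ω, η ω)) = ν := by
  -- `g w` pushes uniform noise to the conditional law under `ν` given `w`, so `g (W ω) (U ω)`
  -- completes the coupling.
  obtain ⟨g, hg, hgν⟩ := Kernel.exists_measurable_map_eq_unitInterval ν.condKernel
  have hη : Measurable fun ω => g (W ω) (U ω) := hg.comp (hW.prodMk hU)
  refine ⟨fun ω => g (W ω) (U ω), hη, ?_⟩
  have hWU : P.map (fun ω => (W ω, U ω)) = (P.map W).prod volume := by
    rw [← hUlaw]
    exact (indepFun_iff_map_prod_eq_prod_map_map hW.aemeasurable hU.aemeasurable).1 hind.symm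
  have : IsProbabilityMeasure (P.map W) := Measure.isProbabilityMeasure_map hW.aemeasurable
  have hm : Measurable fun q : γ × unitInterval => (q.1, g q.1 q.2) := measurable_fst.prodMk hg
  have hcomp : P.map (fun ω => (W ω, g (W ω) (U ω)))
      = ((P.map W).prod volume).map fun q : γ × unitInterval => (q.1, g q.1 q.2) := by
    rw [← hWU, Measure.map_map hm (hW.prodMk hU)]
    rfl
  have : IsProbabilityMeasure (P.map fun ω => (W ω, g (W ω) (U ω))) :=
    Measure.isProbabilityMeasure_map (hW.prodMk hη).aemeasurable
  rw [← ν.disintegrate ν.condKernel, hν]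
  apply Measure.ext_prod
  intro s t hs ht
  rw [hcomp, Measure.map_apply hm (hs.prod ht), Measure.prod_apply (hm (hs.prod ht)),
    Measure.compProd_apply_prod hs ht, ← lintegral_indicator hs]
  refine lintegral_congr fun w => ?_
  by_cases hw : w ∈ s
  · rw [Set.indicator_of_mem hw, ← hgν, Measure.map_apply hg.of_uncurry_left ht]
    congr 1
    ext u
    simp [hw]
  · rw [Set.indicator_of_notMem hw]
    convert measure_empty (μ := (volume : Measure unitInterval))
    ext u
    simp [hw]

end Transfer

/-! ### Joint conditional independence -/

section CondIndep

variable {Ω ι α β : Type*} [MeasurableSpace Ω] [mα : MeasurableSpace α] [MeasurableSpace β]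

/-- If every `Y i` is conditionally independent of the other entries given `X`, then all the entries
are jointly conditionally independent given `X`. -/
theorem condExp_biInter_preimage_ae_eq_prod [Fintype ι] {P : Measure Ω}
    [IsProbabilityMeasure P] {X : Ω → α} (hX : Measurable X) {Y : Ω → ι → β}
    (hci : ∀ i, CondIndepGiven P X (fun ω => Y ω i) fun ω (j : {j // j ≠ i}) => Y ω j.1)
    {A : ι → Set β} (hA : ∀ i, MeasurableSet (A i)) (S : Finset ι) :
    P⟦{ω | ∀ i ∈ S, Y ω i ∈ A i} | mα.comap X⟧ =ᵐ[P]
      ∏ i ∈ S, P⟦(fun ω => Y ω i) ⁻¹' A i | mα.comap X⟧ := by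
  classical
  induction S using Finset.induction_on with
  | empty =>
    simp only [Finset.notMem_empty, false_imp_iff, implies_true, Set.ofPred_true,
      Finset.prod_empty, Set.indicator_univ]
    rw [condExp_const hX.comap_le]
    rfl
  | insert a S ha ih =>
    -- Since `a ∉ S`, the event for `S` involves only coordinates other than `a`, so the hypothesis
    -- at `a` splits off one factor.
    have hB : MeasurableSet {y : {j // j ≠ a} → β | ∀ j : {j // j ≠ a}, j.1 ∈ S → y j ∈ A j.1} := by
      simp only [Set.ofPred_forall]
      exact MeasurableSet.iInter fun j => MeasurableSet.iInter fun _ =>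
        measurable_pi_apply j (hA j.1)
    have h := hci a (A a) _ (hA a) hB
    have e1 : (fun ω (j : {j // j ≠ a}) => Y ω j.1) ⁻¹'
        {y | ∀ j : {j // j ≠ a}, j.1 ∈ S → y j ∈ A j.1} = {ω | ∀ i ∈ S, Y ω i ∈ A i} := by
      ext ω
      exact ⟨fun h i hi => h ⟨i, fun hia => ha (hia ▸ hi)⟩ hi, fun h j hj => h j.1 hj⟩
    have e2 : {ω | ∀ i ∈ insert a S, Y ω i ∈ A i}
        = (fun ω => Y ω a) ⁻¹' A a ∩ {ω | ∀ i ∈ S, Y ω i ∈ A i} := by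
      ext ω
      simp
    rw [e1] at h
    rw [e2, Finset.prod_insert ha]
    exact h.trans (Filter.EventuallyEq.rfl.mul ih)

/-- The joint law of `X` and of a conditionally independent family on measurable boxes. -/
theorem measure_preimage_inter_eq_lintegral_prod_condDistrib [Fintype ι] [StandardBorelSpace β]
    [Nonempty β] {P : Measure Ω} [IsProbabilityMeasure P] {X : Ω → α} (hX : Measurable X)
    {Y : Ω → ι → β} (hY : Measurable Y)
    (hci : ∀ i, CondIndepGiven P X (fun ω => Y ω i) fun ω (j : {j // j ≠ i}) => Y ω j.1)
    {B : Set α} (hB : MeasurableSet B) {A : ι → Set β} (hA : ∀ i, MeasurableSet (A i)) :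
    P (X ⁻¹' B ∩ Y ⁻¹' Set.univ.pi A)
      = ∫⁻ x in B, ∏ i, condDistrib (fun ω => Y ω i) X P x (A i) ∂(P.map X) := by
  have hYi : ∀ i, Measurable fun ω => Y ω i := fun i => (measurable_pi_apply i).comp hY
  have hS : MeasurableSet (Y ⁻¹' Set.univ.pi A) := hY (MeasurableSet.univ_pi hA)
  have hset : {ω | ∀ i ∈ (Finset.univ : Finset ι), Y ω i ∈ A i} = Y ⁻¹' Set.univ.pi A := by
    ext ω
    simp
  have h1 := condExp_biInter_preimage_ae_eq_prod hX hci hA Finset.univ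
  rw [hset] at h1
  have h2 : ∀ᵐ ω ∂P, (P⟦Y ⁻¹' Set.univ.pi A | mα.comap X⟧) ω
      = ∏ i, (condDistrib (fun ω => Y ω i) X P (X ω)).real (A i) := by
    have h3 : ∀ᵐ ω ∂P, ∀ i, (condDistrib (fun ω => Y ω i) X P (X ω)).real (A i)
        = (P⟦(fun ω => Y ω i) ⁻¹' A i | mα.comap X⟧) ω :=
      ae_all_iff.2 fun i => condDistrib_ae_eq_condExp hX (hYi i) (hA i)
    filter_upwards [h1, h3] with ω h1 h3
    rw [h1, Finset.prod_apply]
    exact Finset.prod_congr rfl fun i _ => (h3 i).symm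
  have hmeas : Measurable fun x => ∏ i, condDistrib (fun ω => Y ω i) X P x (A i) :=
    Finset.measurable_prod _ fun i _ => Kernel.measurable_coe _ (hA i)
  have hreal : ∀ x, ∏ i, (condDistrib (fun ω => Y ω i) X P x).real (A i)
      = (∏ i, condDistrib (fun ω => Y ω i) X P x (A i)).toReal := fun x => by
    rw [ENNReal.toReal_prod]
    rfl
  have hfin : ∀ x, ∏ i, condDistrib (fun ω => Y ω i) X P x (A i) ≠ ⊤ := fun x =>
    ENNReal.prod_ne_top fun i _ => measure_ne_top _ _
  -- Conditional expectations are real-valued, so the identity is first obtained for real integrals;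
  -- finiteness of both sides then lifts it to `ENNReal`.
  have h4 : P.real (X ⁻¹' B ∩ Y ⁻¹' Set.univ.pi A)
      = ∫ ω in X ⁻¹' B, (∏ i, condDistrib (fun ω => Y ω i) X P (X ω) (A i)).toReal ∂P := by
    have h5 := setIntegral_condExp hX.comap_le (μ := P)
      (f := (Y ⁻¹' Set.univ.pi A).indicator fun _ => (1 : ℝ))
      ((integrable_const _).indicator hS) (s := X ⁻¹' B) ⟨B, hB, rfl⟩
    rw [setIntegral_indicator hS, setIntegral_const, smul_eq_mul, mul_one] at h5
    rw [← h5]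
    refine integral_congr_ae (ae_restrict_of_ae ?_)
    filter_upwards [h2] with ω h2
    rw [h2, hreal]
  rw [integral_toReal
    (f := fun ω => ∏ i, condDistrib (fun ω => Y ω i) X P (X ω) (A i)) (hmeas.comp hX).aemeasurable
    (Filter.Eventually.of_forall fun ω => (hfin _).lt_top)] at h4
  have hle : ∫⁻ ω in X ⁻¹' B, ∏ i, condDistrib (fun ω => Y ω i) X P (X ω) (A i) ∂P ≠ ⊤ := by
    refine ne_top_of_le_ne_top (b := ∫⁻ _ in X ⁻¹' B, 1 ∂P) (by simp) (lintegral_mono fun ω => ?_)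
    exact Finset.prod_le_one' fun i _ => prob_le_one
  rw [setLIntegral_map hB hmeas hX]
  exact (ENNReal.toReal_eq_toReal_iff' (measure_ne_top _ _) hle).1 h4

end CondIndep

/-! ### Measures on products and their values on boxes -/

section Pi

variable {ι α β E : Type*} [Fintype ι] [MeasurableSpace α] [MeasurableSpace β]
  [MeasurableSpace E]

/-- Two finite measures on `α × (ι → β)` agree if they agree on measurable boxes. -/
theorem ext_prod_pi {μ ν : Measure (α × (ι → β))} [IsFiniteMeasure μ]
    (h : ∀ (B : Set α) (A : ι → Set β), MeasurableSet B → (∀ i, MeasurableSet (A i)) →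
      μ (B ×ˢ Set.univ.pi A) = ν (B ×ˢ Set.univ.pi A)) : μ = ν := by
  refine ext_of_generate_finite
    (Set.image2 (· ×ˢ ·) {s : Set α | MeasurableSet s}
      (Set.pi Set.univ '' Set.pi Set.univ fun _ : ι => {s : Set β | MeasurableSet s})) ?_ ?_ ?_ ?_
  · refine (generateFrom_eq_prod MeasurableSpace.generateFrom_measurableSet generateFrom_pi
      isCountablySpanning_measurableSet ?_).symm
    exact IsCountablySpanning.pi fun _ => isCountablySpanning_measurableSet
  · exact MeasurableSpace.isPiSystem_measurableSet.prod
      (IsPiSystem.pi fun _ => MeasurableSpace.isPiSystem_measurableSet)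
  · rintro _ ⟨B, hB, _, ⟨A, hA, rfl⟩, rfl⟩
    exact h B A hB fun i => hA i (Set.mem_univ i)
  · simpa using h Set.univ (fun _ => Set.univ) MeasurableSet.univ fun _ => MeasurableSet.univ

/-- Applying `f i` to a random element and to the `i`-th coordinate of independent noise, for every
`i`, gives a law whose value on boxes is an integral of a product. -/
theorem map_prod_pi_box {μ : Measure α} [SFinite μ] {ν : Measure E} [IsProbabilityMeasure ν]
    {f : ι → α → E → β} (hf : ∀ i, Measurable (Function.uncurry (f i)))
    {B : Set α} (hB : MeasurableSet B) {A : ι → Set β} (hA : ∀ i, MeasurableSet (A i)) :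
    (μ.prod (Measure.pi fun _ : ι => ν)).map (fun q => (q.1, fun i => f i q.1 (q.2 i)))
        (B ×ˢ Set.univ.pi A)
      = ∫⁻ x in B, ∏ i, ν.map (f i x) (A i) ∂μ := by
  have hm : Measurable fun q : α × (ι → E) => (q.1, fun i => f i q.1 (q.2 i)) :=
    measurable_fst.prodMk <| measurable_pi_lambda _ fun i =>
      (hf i).comp (measurable_fst.prodMk ((measurable_pi_apply i).comp measurable_snd))
  have hs := hB.prod (MeasurableSet.univ_pi hA)
  rw [Measure.map_apply hm hs, Measure.prod_apply (hm hs), ← lintegral_indicator hB]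
  refine lintegral_congr fun x => ?_
  by_cases hx : x ∈ B
  · rw [Set.indicator_of_mem hx]
    have : Prod.mk x ⁻¹' ((fun q : α × (ι → E) => (q.1, fun i => f i q.1 (q.2 i))) ⁻¹'
        (B ×ˢ Set.univ.pi A)) = Set.univ.pi fun i => f i x ⁻¹' A i := by
      ext e
      simp [hx]
    rw [this, Measure.pi_pi]
    exact Finset.prod_congr rfl fun i _ => (Measure.map_apply (hf i).of_uncurry_left (hA i)).symm
  · rw [Set.indicator_of_notMem hx]
    convert measure_empty (μ := Measure.pi fun _ : ι => ν)
    ext e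
    simp [hx]

end Pi

end ExchArray

/-! ### Symmetries of arrays and augmented canonical forms -/

namespace ExchArray

variable {d : ℕ} {n : Fin d → ℕ} {α β : Type*}

theorem act_act (σ π : PermGroup n) (x : Arr n α) : act σ (act π x) = act (π * σ) x := rfl

theorem act_one (x : Arr n α) : act 1 x = x := rfl

theorem permIdx_injective (π : PermGroup n) : Function.Injective (permIdx π) := fun _ _ h =>
  funext fun k => (π k).injective (congrFun h k)

theorem measurable_act [MeasurableSpace α] (π : PermGroup n) :
    Measurable (act π : Arr n α → Arr n α) :=
  measurable_pi_lambda _ fun _ => measurable_pi_apply _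

/-- If the slices of `C` through `p` and through `q` agree in every direction, then exchanging
`p k` and `q k` in every direction `k` is a symmetry of `C`. -/
theorem act_swap_eq_self {C : Arr n α} {p q : Idx n}
    (h : ∀ k j, C (mixIdx p {k} j) = C (mixIdx q {k} j)) :
    act (fun k => Equiv.swap (p k) (q k)) C = C := by
  classical
  have hmix : ∀ (r : Idx n) k j, mixIdx r {k} j = Function.update j k (r k) := by
    intro r k j
    funext l
    by_cases hl : l = k
    · subst hl
      simp [mixIdx]
    · simp [mixIdx, hl]
  simp only [hmix] at h
  -- In a single direction the swap only exchanges the slices at `p k` and `q k`, which agree by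
  -- `h`.
  have step : ∀ k j, C (Function.update j k (Equiv.swap (p k) (q k) (j k))) = C j := by
    intro k j
    by_cases hp : j k = p k
    · rw [hp, Equiv.swap_apply_left, ← h, ← hp, Function.update_eq_self]
    · by_cases hq : j k = q k
      · rw [hq, Equiv.swap_apply_right, h, ← hq, Function.update_eq_self]
      · rw [Equiv.swap_apply_of_ne_of_ne hp hq, Function.update_eq_self]
  -- Swaps in different directions affect different coordinates, so they can be performed one at a
  -- time; `S` holds the directions done so far.
  have main : ∀ (S : Finset (Fin d)) (j : Idx n),
      C (fun k => if k ∈ S then Equiv.swap (p k) (q k) (j k) else j k) = C j := by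
    intro S
    induction S using Finset.induction_on with
    | empty => simp
    | insert a S ha ih =>
      intro j
      rw [← ih j, ← step a fun k => if k ∈ S then Equiv.swap (p k) (q k) (j k) else j k]
      congr 1
      funext l
      by_cases hl : l = a
      · subst hl
        simp [ha]
      · simp [hl]
  funext j
  have h1 := main Finset.univ j
  simp only [Finset.mem_univ, if_true] at h1
  exact h1

/-- The places in the canonical form that are compatible with an augmented canonical form. -/
def AugArr.places {p : ℕ} (z : AugArr n p α) : Set (Idx n) :=
  {q | ∀ j s, (z j).2 s = (z (mixIdx q s.1 j)).1}

theorem AugArr.measurable_places {p : ℕ} [MeasurableSpace α] [StandardBorelSpace α] :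
    Measurable (AugArr.places : AugArr n p α → Set (Idx n)) := by
  rw [measurable_set_iff]
  intro q
  refine Measurable.forall fun j => Measurable.forall fun s => ?_
  exact measurableSet_setOfPred.1 (measurableSet_eq_fun
    ((measurable_pi_apply s).comp (measurable_snd.comp (measurable_pi_apply j)))
    (measurable_fst.comp (measurable_pi_apply _)))

/-- There is a measurable way to read off a compatible place from an augmented canonical form. -/
theorem AugArr.exists_measurable_place {p : ℕ} [MeasurableSpace α] [StandardBorelSpace α]
    [Nonempty (Idx n)] :
    ∃ g : AugArr n p α → Idx n, Measurable g ∧ ∀ z, z.places.Nonempty → g z ∈ z.places := by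
  classical
  -- The default value is irrelevant for genuine augmented forms: `pos_mem_places` makes their set
  -- of places nonempty.
  let s : Set (Idx n) → Idx n := fun T =>
    if h : T.Nonempty then h.some else Classical.arbitrary (Idx n)
  refine ⟨fun z => s z.places, (measurable_of_finite s).comp AugArr.measurable_places,
    fun z hz => ?_⟩
  simp only [s, dif_pos hz]
  exact hz.some_mem

variable [MeasurableSpace α]

theorem Canonicalization.measurable_aug (c : Canonicalization n α) (p : ℕ) (i : Idx n) :
    Measurable fun x => c.aug p x i := by
  refine measurable_pi_lambda _ fun j => Measurable.prodMk
    ((measurable_pi_apply j).comp c.measurable_canon) (measurable_pi_lambda _ fun s => ?_)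
  -- The index of evaluation varies with `x`, but it ranges over a countable set.
  have h : Measurable fun q : Arr n α × Idx n => q.1 (mixIdx q.2 s.1 j) :=
    measurable_from_prod_countable_left fun q => measurable_pi_apply (mixIdx q s.1 j)
  exact h.comp (c.measurable_canon.prodMk (c.measurable_pos i))

theorem Canonicalization.aug_act (c : Canonicalization n α) (p : ℕ) (π : PermGroup n)
    (x : Arr n α) (i : Idx n) : c.aug p (act π x) i = c.aug p x (permIdx π i) := by
  funext j
  rw [Canonicalization.aug, Canonicalization.aug, c.canon_act, c.pos_act]

theorem Canonicalization.pos_mem_places (c : Canonicalization n α) (p : ℕ) (x : Arr n α)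
    (i : Idx n) : c.pos x i ∈ (c.aug p x i).places := fun _ _ => rfl

/-- A place compatible with the `d`-augmented canonical form is a place of the given index for some
permutation that carries the array to its canonical form. -/
theorem Canonicalization.exists_perm_of_mem_places (c : Canonicalization n α) {x : Arr n α}
    {i q : Idx n} (hq : q ∈ (c.aug d x i).places) :
    ∃ π : PermGroup n, c.canon x = act π x ∧ permIdx π q = i := by
  classical
  obtain ⟨π, hπ, hi⟩ := c.exists_perm x i
  -- Only the singletons `{k}` are needed; they are admissible because the existence of `k : Fin d`
  -- forces `1 ≤ d`.
  have h := act_swap_eq_self (C := c.canon x) (p := q) (q := c.pos x i) fun k j =>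
    (hq j ⟨{k}, by simpa using Nat.one_le_iff_ne_zero.2 k.pos.ne'⟩).symm
  -- The swaps fix the canonical form and carry `q` to `c.pos x i`, which `π` carries to `i`.
  refine ⟨π * fun k => Equiv.swap (q k) (c.pos x i k), ?_, ?_⟩
  · rw [← act_act, ← hπ, h]
  · refine Eq.trans (funext fun k => ?_) hi
    simp [permIdx]

/-! ### Equivariance, joint exchangeability and conditional laws -/

variable [MeasurableSpace β] {Ω : Type*} [MeasurableSpace Ω] {P : Measure Ω}
  {X : Ω → Arr n α} {Y : Ω → Arr n β}

/-- Taking the whole space as the event for Y shows that the two conditioning events have equal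
probability, so the quotients agree. -/
theorem condEquivariant_of_map_eq (hX : Measurable X) (hY : Measurable Y)
    (h : ∀ π : PermGroup n,
      P.map (fun ω => (act π (X ω), act π (Y ω))) = P.map fun ω => (X ω, Y ω)) :
    CondEquivariant P X Y := by
  intro π A B hA hB _ _
  have hXπ : Measurable fun ω => act π (X ω) := (measurable_act π).comp hX
  have hYπ : Measurable fun ω => act π (Y ω) := (measurable_act π).comp hY
  have key : ∀ S : Set (Arr n β), MeasurableSet S →
      P ({ω | X ω ∈ B} ∩ {ω | Y ω ∈ S})
        = P ({ω | act π (X ω) ∈ B} ∩ {ω | act π (Y ω) ∈ S}) := by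
    intro S hS
    have h1 := congrArg (fun μ : Measure (Arr n α × Arr n β) => μ (B ×ˢ S)) (h π)
    beta_reduce at h1
    rw [Measure.map_apply (hXπ.prodMk hYπ) (hB.prod hS),
      Measure.map_apply (hX.prodMk hY) (hB.prod hS)] at h1
    exact h1.symm
  have hu := key Set.univ MeasurableSet.univ
  simp only [Set.mem_univ, Set.ofPred_true, Set.inter_univ] at hu
  rw [cond_apply (s := {ω | X ω ∈ B}) (hX hB), cond_apply (s := {ω | act π (X ω) ∈ B}) (hXπ hB),
    hu, key A hA]

/-- Exchangeability of X gives both conditioning events the same probability, which can be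
multiplied out; when it is zero, both joint probabilities vanish. -/
theorem CondEquivariant.map_eq [IsProbabilityMeasure P] (hX : Measurable X) (hY : Measurable Y)
    (hexch : SeparatelyExchangeable P X) (h : CondEquivariant P X Y) (π : PermGroup n) :
    P.map (fun ω => (act π (X ω), act π (Y ω))) = P.map fun ω => (X ω, Y ω) := by
  have hXπ : Measurable fun ω => act π (X ω) := (measurable_act π).comp hX
  have hYπ : Measurable fun ω => act π (Y ω) := (measurable_act π).comp hY
  have : IsProbabilityMeasure (P.map fun ω => (act π (X ω), act π (Y ω))) :=
    Measure.isProbabilityMeasure_map (hXπ.prodMk hYπ).aemeasurable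
  refine Measure.ext_prod fun {B A} hB hA => ?_
  rw [Measure.map_apply (hXπ.prodMk hYπ) (hB.prod hA),
    Measure.map_apply (hX.prodMk hY) (hB.prod hA)]
  have hBB : P {ω | act π (X ω) ∈ B} = P {ω | X ω ∈ B} := by
    have h1 := congrArg (fun μ : Measure (Arr n α) => μ B) (hexch π)
    beta_reduce at h1
    rwa [Measure.map_apply hXπ hB, Measure.map_apply hX hB] at h1
  change P ({ω | act π (X ω) ∈ B} ∩ {ω | act π (Y ω) ∈ A})
    = P ({ω | X ω ∈ B} ∩ {ω | Y ω ∈ A})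
  by_cases h0 : P {ω | X ω ∈ B} = 0
  · rw [measure_mono_null Set.inter_subset_left h0,
      measure_mono_null Set.inter_subset_left (hBB.trans h0)]
  · have h2 := h π A B hA hB h0 (hBB ▸ h0)
    rw [cond_apply (s := {ω | X ω ∈ B}) (hX hB),
      cond_apply (s := {ω | act π (X ω) ∈ B}) (hXπ hB), hBB] at h2
    exact ((ENNReal.mul_right_inj (ENNReal.inv_ne_zero.2 (measure_ne_top _ _))
      (ENNReal.inv_ne_top.2 h0)).1 h2).symm

/-- For a jointly exchangeable pair of arrays, the conditional distributions of the entries of `Y`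
are almost surely equivariant. -/
theorem condDistrib_act_ae_eq [IsProbabilityMeasure P] [StandardBorelSpace β] [Nonempty β]
    (hX : Measurable X) (hY : Measurable Y) (hexch : SeparatelyExchangeable P X) (π : PermGroup n)
    (h : P.map (fun ω => (act π (X ω), act π (Y ω))) = P.map fun ω => (X ω, Y ω)) (i : Idx n) :
    ∀ᵐ x ∂(P.map X), condDistrib (fun ω => Y ω (permIdx π i)) X P x
      = condDistrib (fun ω => Y ω i) X P (act π x) := by
  have hYi : ∀ i, Measurable fun ω => Y ω i := fun i => (measurable_pi_apply i).comp hY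
  have hm : Measurable (act π : Arr n α → Arr n α) := measurable_act π
  have hXπ : Measurable fun ω => act π (X ω) := hm.comp hX
  have hYπ : Measurable fun ω => act π (Y ω) := (measurable_act π).comp hY
  have : IsProbabilityMeasure (P.map X) := Measure.isProbabilityMeasure_map hX.aemeasurable
  have hmapX : (P.map X).map (act π) = P.map X := by
    rw [Measure.map_map hm hX]
    exact hexch π
  -- By uniqueness of conditional distributions, it suffices that the kernel pulled back along `act
  -- π` yields the joint law of X and the entry at `permIdx π i`.
  refine condDistrib_ae_eq_of_measure_eq_compProd (κ := (condDistrib (fun ω => Y ω i) X P).comap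
    (act π) hm) X (hYi _).aemeasurable ?_
  have : IsProbabilityMeasure (P.map fun ω => (X ω, Y ω (permIdx π i))) :=
    Measure.isProbabilityMeasure_map (hX.prodMk (hYi _)).aemeasurable
  refine Measure.ext_prod fun {B A} hB hA => ?_
  have hB' : MeasurableSet (act π⁻¹ ⁻¹' B : Set (Arr n α)) := measurable_act _ hB
  have hBB : act π ⁻¹' (act π⁻¹ ⁻¹' B) = B := by
    ext x
    simp [act_act, act_one]
  rw [Measure.compProd_apply_prod hB hA]
  simp only [Kernel.comap_apply]
  have e1 : ∫⁻ x in B, condDistrib (fun ω => Y ω i) X P (act π x) A ∂(P.map X)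
      = ∫⁻ x in act π⁻¹ ⁻¹' B, condDistrib (fun ω => Y ω i) X P x A ∂(P.map X) := by
    conv_rhs => rw [← hmapX]
    rw [setLIntegral_map hB' (Kernel.measurable_coe _ hA) hm, hBB]
  rw [e1, ← Measure.compProd_apply_prod hB' hA, compProd_map_condDistrib (hYi i).aemeasurable,
    Measure.map_apply (hX.prodMk (hYi _)) (hB.prod hA),
    Measure.map_apply (hX.prodMk (hYi _)) (hB'.prod hA)]
  have hT : MeasurableSet ((act π⁻¹ ⁻¹' B) ×ˢ ((fun y : Arr n β => y i) ⁻¹' A)) :=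
    hB'.prod (measurable_pi_apply i hA)
  have h1 := congrArg (fun μ : Measure (Arr n α × Arr n β) =>
    μ ((act π⁻¹ ⁻¹' B) ×ˢ ((fun y : Arr n β => y i) ⁻¹' A))) h
  beta_reduce at h1
  rw [Measure.map_apply (hXπ.prodMk hYπ) hT,
    Measure.map_apply (hX.prodMk hY) hT] at h1
  refine Eq.trans (congrArg P ?_) h1
  exact congrArg (fun T => X ⁻¹' T ∩ (fun ω => Y ω (permIdx π i)) ⁻¹' A) hBB.symm

/-- The conditional distribution of an entry of `Y` given `X` can almost surely be read off from the
canonical form of `X` and any place compatible with the `d`-augmented canonical form. -/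
theorem condDistrib_canon_ae_eq [IsProbabilityMeasure P] [StandardBorelSpace β] [Nonempty β]
    (hX : Measurable X) (hY : Measurable Y) (hexch : SeparatelyExchangeable P X)
    (h : ∀ π : PermGroup n,
      P.map (fun ω => (act π (X ω), act π (Y ω))) = P.map fun ω => (X ω, Y ω))
    (c : Canonicalization n α) :
    ∀ᵐ x ∂(P.map X), ∀ i, ∀ q ∈ (c.aug d x i).places,
      condDistrib (fun ω => Y ω q) X P (c.canon x) = condDistrib (fun ω => Y ω i) X P x := by
  -- The canonical forms may themselves be a null set. Evaluating a version of the kernel there is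
  -- harmless because `c.canon x = act π x`, and one null set of `x` serves the finitely many `π`
  -- and `i`.
  filter_upwards [ae_all_iff.2 fun π => ae_all_iff.2
    fun i => condDistrib_act_ae_eq hX hY hexch π (h π) i] with x hx i q hq
  obtain ⟨π, hπ, rfl⟩ := c.exists_perm_of_mem_places hq
  rw [hπ, hx]

/-- A measurable function of noise and of the `d`-augmented canonical form that reproduces the
conditional distributions of the entries of `Y` given `X`. -/
theorem exists_measurable_map_eq_condDistrib [IsProbabilityMeasure P] [StandardBorelSpace α]
    [StandardBorelSpace β] [Nonempty β] [Nonempty (Idx n)]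
    (hX : Measurable X) (hY : Measurable Y) (hexch : SeparatelyExchangeable P X)
    (h : ∀ π : PermGroup n,
      P.map (fun ω => (act π (X ω), act π (Y ω))) = P.map fun ω => (X ω, Y ω))
    (c : Canonicalization n α) :
    ∃ f : unitInterval × α × AugArr n d α → β, Measurable f ∧
      ∀ᵐ x ∂(P.map X), ∀ i,
        volume.map (fun u => f (u, x i, c.aug d x i)) = condDistrib (fun ω => Y ω i) X P x := by
  obtain ⟨g, hg, hgp⟩ := AugArr.exists_measurable_place (n := n) (p := d) (α := α)
  -- Making the index part of the kernel's argument lets a single `F`, hence a single `f`, serve all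
  -- entries.
  let κ : Kernel (Idx n × Arr n α) β :=
    { toFun := fun q => condDistrib (fun ω => Y ω q.1) X P q.2
      measurable' := measurable_from_prod_countable_right fun i =>
        Kernel.measurable (condDistrib (fun ω => Y ω i) X P) }
  have hκ : IsMarkovKernel κ := ⟨fun q => by
    change IsProbabilityMeasure (condDistrib (fun ω => Y ω q.1) X P q.2)
    infer_instance⟩
  obtain ⟨F, hF, hFκ⟩ := κ.exists_measurable_map_eq_unitInterval
  -- The entry `x i` is ignored: the augmented form already contains it, under `s = [d]`.
  refine ⟨fun q => F (g q.2.2, fun j => (q.2.2 j).1) q.1, ?_, ?_⟩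
  · have hz : Measurable fun z : AugArr n d α => (g z, fun j => (z j).1) :=
      hg.prodMk (measurable_pi_lambda _ fun j => measurable_fst.comp (measurable_pi_apply j))
    exact hF.comp ((hz.comp (measurable_snd.comp measurable_snd)).prodMk measurable_fst)
  · filter_upwards [condDistrib_canon_ae_eq hX hY hexch h c] with x hx i
    exact (hFκ _).trans (hx i _ (hgp _ ⟨_, c.pos_mem_places d x i⟩))

/-- The representation by noise and augmented canonical forms makes the pair of arrays jointly
exchangeable. -/
theorem map_act_eq_of_representation [IsProbabilityMeasure P] (hX : Measurable X)
    (hexch : SeparatelyExchangeable P X) (c : Canonicalization n α)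
    {f : unitInterval × α × AugArr n d α → β} (hf : Measurable f)
    {η : Idx n → Ω → unitInterval} (hη : ∀ i, Measurable (η i))
    (hηlaw : ∀ i, P.map (η i) = volume) (hηind : iIndepFun η P)
    (hηX : IndepFun (fun ω i => η i ω) X P)
    (hYf : ∀ᵐ ω ∂P, ∀ i, Y ω i = f (η i ω, X ω i, c.aug d (X ω) i)) (π : PermGroup n) :
    P.map (fun ω => (act π (X ω), act π (Y ω))) = P.map fun ω => (X ω, Y ω) := by
  let G : Arr n unitInterval × Arr n α → Arr n α × Arr n β := fun q =>
    (q.2, fun i => f (q.1 i, q.2 i, c.aug d q.2 i))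
  have hG : Measurable G := measurable_snd.prodMk <| measurable_pi_lambda _ fun i => hf.comp <|
    ((measurable_pi_apply i).comp measurable_fst).prodMk <|
      ((measurable_pi_apply i).comp measurable_snd).prodMk
        ((c.measurable_aug d i).comp measurable_snd)
  have hη' : Measurable fun ω i => η i ω := measurable_pi_lambda _ hη
  have hXπ : Measurable fun ω => act π (X ω) := (measurable_act π).comp hX
  have hηπ : Measurable fun ω => act π fun i => η i ω := (measurable_act π).comp hη'
  -- Reindexing i.i.d. noise by the injective map `permIdx π` preserves its law, and the noise is
  -- independent of X.
  have hlaw : P.map (fun ω => (act π fun i => η i ω, act π (X ω)))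
      = P.map fun ω => ((fun i => η i ω), X ω) := by
    have h1 : IndepFun (fun ω => act π fun i => η i ω) (fun ω => act π (X ω)) P :=
      hηX.comp (measurable_act π) (measurable_act π)
    rw [(indepFun_iff_map_prod_eq_prod_map_map hηπ.aemeasurable hXπ.aemeasurable).1 h1,
      (indepFun_iff_map_prod_eq_prod_map_map hη'.aemeasurable hX.aemeasurable).1 hηX, hexch π]
    congr 1
    have h2 := (iIndepFun_iff_map_fun_eq_pi_map fun i => (hη i).aemeasurable).1 hηind
    have h3 := (iIndepFun_iff_map_fun_eq_pi_map fun i => (hη (permIdx π i)).aemeasurable).1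
      (hηind.precomp (permIdx_injective π))
    simp only [hηlaw] at h2 h3
    rw [h2]
    exact h3
  have e1 : P.map (fun ω => (X ω, Y ω)) = (P.map fun ω => ((fun i => η i ω), X ω)).map G := by
    rw [Measure.map_map hG (hη'.prodMk hX)]
    refine Measure.map_congr ?_
    filter_upwards [hYf] with ω hω
    exact Prod.ext rfl (funext hω)
  -- `aug_act` makes `G` commute with permutations.
  have e2 : P.map (fun ω => (act π (X ω), act π (Y ω)))
      = (P.map fun ω => (act π fun i => η i ω, act π (X ω))).map G := by
    rw [Measure.map_map hG (hηπ.prodMk hXπ)]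
    refine Measure.map_congr ?_
    filter_upwards [hYf] with ω hω
    refine Prod.ext rfl (funext fun i => ?_)
    simp only [Function.comp, G, c.aug_act]
    exact hω _
  rw [e1, e2, hlaw]

end ExchArray

/-! ### Noise outsourcing -/

namespace ExchArray

variable {d : ℕ} {n : Fin d → ℕ} {α β Ω : Type*} [MeasurableSpace α] [MeasurableSpace β]
  [MeasurableSpace Ω] {P : Measure Ω} {X : Ω → Arr n α} {Y : Ω → Arr n β}

/-- Noise outsourcing for conditionally independent entries whose conditional distributions are
represented by `f`. -/
theorem exists_noise_representation [IsProbabilityMeasure P] [StandardBorelSpace β] [Nonempty β]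
    (hX : Measurable X) (hY : Measurable Y)
    (hrich : ∃ U : Ω → unitInterval, Measurable U ∧ P.map U = volume ∧
      IndepFun U (fun ω => (X ω, Y ω)) P)
    (hci : EntriesCondIndep P X Y) {f : Idx n → Arr n α → unitInterval → β}
    (hf : ∀ i, Measurable (Function.uncurry (f i)))
    (hfκ : ∀ᵐ x ∂(P.map X), ∀ i,
      volume.map (f i x) = condDistrib (fun ω => Y ω i) X P x) :
    ∃ η : Idx n → Ω → unitInterval, (∀ i, Measurable (η i)) ∧ (∀ i, P.map (η i) = volume) ∧
      iIndepFun η P ∧ IndepFun (fun ω i => η i ω) X P ∧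
      ∀ᵐ ω ∂P, ∀ i, Y ω i = f i (X ω) (η i ω) := by
  obtain ⟨U, hU, hUlaw, hUind⟩ := hrich
  have hPX : IsProbabilityMeasure (P.map X) := Measure.isProbabilityMeasure_map hX.aemeasurable
  let ρ : Measure (Arr n unitInterval) := Measure.pi fun _ => volume
  let G : Arr n α × Arr n unitInterval → Arr n α × Arr n β := fun q =>
    (q.1, fun i => f i q.1 (q.2 i))
  have hG : Measurable G := measurable_fst.prodMk <| measurable_pi_lambda _ fun i =>
    (hf i).comp (measurable_fst.prodMk ((measurable_pi_apply i).comp measurable_snd))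
  -- On a box both sides integrate the product of the conditional laws of the entries.
  have hGlaw : ((P.map X).prod ρ).map G = P.map fun ω => (X ω, Y ω) := by
    have : IsProbabilityMeasure (((P.map X).prod ρ).map G) :=
      Measure.isProbabilityMeasure_map hG.aemeasurable
    refine ext_prod_pi fun B A hB hA => ?_
    refine (map_prod_pi_box hf hB hA).trans ?_
    rw [Measure.map_apply (hX.prodMk hY) (hB.prod (MeasurableSet.univ_pi hA))]
    refine Eq.trans ?_
      (measure_preimage_inter_eq_lintegral_prod_condDistrib hX hY hci hB hA).symm
    refine lintegral_congr_ae (ae_restrict_of_ae ?_)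
    filter_upwards [hfκ] with x hx
    simp only [hx]
  have hGe : Measurable fun q : Arr n α × Arr n unitInterval => (G q, q.2) :=
    hG.prodMk measurable_snd
  -- Y is given in advance, so the noise is recovered from (X, Y) with the help of `U`, through the
  -- coupling of `G q` with the noise `q.2` that produced it.
  obtain ⟨e, he, hlaw⟩ := exists_map_prodMk_eq_of_uniform (hX.prodMk hY) hU hUlaw hUind
    (((P.map X).prod ρ).map fun q => (G q, q.2)) (by
      rw [Measure.fst, Measure.map_map measurable_fst hGe, ← hGlaw]
      rfl)
  have hXe : P.map (fun ω => (X ω, e ω)) = (P.map X).prod ρ := by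
    have hp : Measurable fun q : (Arr n α × Arr n β) × Arr n unitInterval => (q.1.1, q.2) := by
      fun_prop
    have h1 := congrArg (Measure.map fun q => (q.1.1, q.2)) hlaw
    rw [Measure.map_map hp ((hX.prodMk hY).prodMk he), Measure.map_map hp hGe] at h1
    exact h1.trans Measure.map_id
  have heρ : P.map e = ρ := by
    have h1 := congrArg Measure.snd hXe
    rwa [Measure.snd_map_prodMk hX, Measure.snd_prod] at h1
  have hei : ∀ i, Measurable fun ω => e ω i := fun i => (measurable_pi_apply i).comp he
  have hei' : ∀ i, P.map (fun ω => e ω i) = volume := fun i => by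
    have h1 := (measurePreserving_eval (fun _ : Idx n => (volume : Measure unitInterval)) i).map_eq
    change ρ.map _ = _ at h1
    rw [← heρ, Measure.map_map (measurable_pi_apply i) he] at h1
    exact h1
  refine ⟨fun i ω => e ω i, hei, hei', ?_, ?_, ?_⟩
  · rw [iIndepFun_iff_map_fun_eq_pi_map fun i => (hei i).aemeasurable]
    simp only [hei']
    exact heρ
  · refine IndepFun.symm ?_
    rw [indepFun_iff_map_prod_eq_prod_map_map hX.aemeasurable he.aemeasurable]
    exact hXe.trans (by rw [← heρ])
  · have hS : MeasurableSet {q : (Arr n α × Arr n β) × Arr n unitInterval |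
        q.1.2 = fun i => f i q.1.1 (q.2 i)} :=
      measurableSet_eq_fun (measurable_snd.comp measurable_fst) <| measurable_snd.comp <|
        hG.comp ((measurable_fst.comp measurable_fst).prodMk measurable_snd)
    -- The identity is a measurable property of the joint law, and it holds everywhere in the model.
    have h1 : ∀ᵐ q ∂(P.map fun ω => ((X ω, Y ω), e ω)), q.1.2 = fun i => f i q.1.1 (q.2 i) := by
      rw [hlaw]
      exact (ae_map_iff hGe.aemeasurable hS).2 (Filter.Eventually.of_forall fun _ => rfl)
    filter_upwards [(ae_map_iff ((hX.prodMk hY).prodMk he).aemeasurable hS).1 h1] with ω hω i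
    exact congrFun hω i

end ExchArray

/-! ### The representation theorem -/

theorem mainTheorem12 {Ω 𝒳 𝒴 : Type*} [MeasurableSpace Ω] (P : Measure Ω) [IsProbabilityMeasure P]
    [MeasurableSpace 𝒳] [StandardBorelSpace 𝒳] [MeasurableSpace 𝒴] [StandardBorelSpace 𝒴]
    {d : ℕ} (n : Fin d → ℕ) (hn : ∀ k, 0 < n k) (c : Canonicalization n 𝒳)
    (X : Ω → Arr n 𝒳) (hX : Measurable X) (Y : Ω → Arr n 𝒴) (hY : Measurable Y)
    -- the sample space is rich enough: it carries a uniform variable independent of the data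
    (hrich : ∃ U : Ω → unitInterval, Measurable U ∧ P.map U = volume ∧
      IndepFun U (fun ω => (X ω, Y ω)) P)
    (hexch : SeparatelyExchangeable P X)
    (hci : EntriesCondIndep P X Y) :
    CondEquivariant P X Y ↔
      ∃ (f : unitInterval × 𝒳 × AugArr n d 𝒳 → 𝒴) (η : Idx n → Ω → unitInterval),
        Measurable f ∧
        (∀ i, Measurable (η i)) ∧ (∀ i, P.map (η i) = volume) ∧ iIndepFun η P ∧
        IndepFun (fun ω i => η i ω) X P ∧
        ∀ᵐ ω ∂P, ∀ i, Y ω i = f (η i ω, X ω i, c.aug d (X ω) i) := by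

  constructor
  · intro h
    -- Positive sizes provide an index, and with it a value in `𝒴`; conditional distributions need a
    -- nonempty target.
    have : Nonempty (Idx n) := ⟨fun k => ⟨0, hn k⟩⟩
    have : Nonempty 𝒴 := by
      obtain ⟨ω⟩ := nonempty_of_isProbabilityMeasure P
      exact ⟨Y ω (Classical.arbitrary _)⟩
    obtain ⟨f, hf, hfκ⟩ := exists_measurable_map_eq_condDistrib hX hY hexch
      (fun π => h.map_eq hX hY hexch π) c
    have hf' : ∀ i, Measurable (Function.uncurry fun (x : Arr n 𝒳) (u : unitInterval) =>
        f (u, x i, c.aug d x i)) := fun i => hf.comp <| measurable_snd.prodMk <|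
      ((measurable_pi_apply i).comp measurable_fst).prodMk
        ((c.measurable_aug d i).comp measurable_fst)
    obtain ⟨η, h1, h2, h3, h4, h5⟩ := exists_noise_representation hX hY hrich hci hf' hfκ
    exact ⟨f, η, hf, h1, h2, h3, h4, h5⟩
  · rintro ⟨f, η, hf, h1, h2, h3, h4, h5⟩
    exact condEquivariant_of_map_eq hX hY
      (map_act_eq_of_representation hX hexch c hf h1 h2 h3 h4 h5)
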